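/- Let $n\ge 2$ and $m\ge 1$ be integers. Let $\varepsilon_1,\dots,\varepsilon_n$ be the standard basis of $\mathbb{R}^n$ with the standard inner product $\langle\cdot,\cdot\rangle$, and let $V=\{a\in\mathbb{R}^n : a_1+\cdots+a_n=0\}$. For $1\le i\le j\le n-1$ put $\alpha_{ij}=\varepsilon_i-\varepsilon_{j+1}$, and let $\theta=\alpha_{1,n-1}$. For $k\in\mathbb{Z}$ let $H_{\alpha,k}=\{v\in V:\langle v,\alpha\rangle=k\}$. The $m$-Shi arrangement is the set of all hyperplanes $H_{\alpha_{ij},k}$ with $1\le i\le j\le n-1$ and $-m<k\le m$. Its regions are the connected components of the complement in $V$ of the union of these hyperplanes, and a region is dominant if it is contained in the dominant chamber $\{v\in V:\langle v,\alpha_{ii}\rangle\ge 0 \text{ for } 1\le i\le n-1\}$. Let $A_0$ be the fundamental alcove, that is, the interior of $\{v\in V:\langle v,\theta\rangle\le 1,\ \langle v,\alpha_{ii}\rangle\ge 0\text{ for }1\le i\le n-1\}$. A hyperplane $H_{\alpha,k}$ separates two open sets if one of them lies in $\{v\in V:\langle v,\alpha\rangle\ge k\}$ and the other in $\{v\in V:\langle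 v,\alpha\rangle\le k\}$. A separating wall of a region $R$ is a hyperplane of the arrangement that supports a facet of $R$ and separates $R$ from $A_0$. For a dominant region $R$ put $$c(R)=\#\{(i,k): 1\le i\le n-1,\ 1\le k\le m,\ H_{\alpha_{i,n-1},k}\text{ separates }R\text{ from }A_0\},$$ $$r(R)=\#\{(j,k): 1\le j\le n-1,\ 1\le k\le m,\ H_{\alpha_{1j},k}\text{ separates }R\text{ from }A_0\}.$$ Then only finitely many dominant regions of the $m$-Shi arrangement have $H_{\theta,m}$ as a separating wall, and $$\sum_{R} p^{c(R)}q^{r(R)} = p^m q^m\,[m]_{p,q}^{\,n-2},\qquad [m]_{p,q}=\sum_{j=0}^{m-1}p^{j}q^{m-1-j},$$ where the sum is over all dominant regions $R$ of the $m$-Shi arrangement that have $H_{\theta,m}$ as a separating wall. The identity holds for indeterminates $p,q$, equivalently for all elements $p,q$ of any commutative semiring. -/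

import Mathlib

namespace Shi

/-- The ambient Euclidean space `ℝⁿ`. -/
abbrev Amb (n : ℕ) : Type := EuclideanSpace ℝ (Fin n)

/-- The subspace of `ℝⁿ` of vectors whose coordinates sum to zero. -/
def sumZero (n : ℕ) : Submodule ℝ (Amb n) where
  carrier := {a | ∑ i, a i = 0}
  zero_mem' := by simp
  add_mem' := by
    intro a b ha hb
    simp only [Set.mem_ofPred_eq] at ha hb ⊢
    simp [Finset.sum_add_distrib, ha, hb]
  smul_mem' := by
    intro c a ha
    simp only [Set.mem_ofPred_eq] at ha ⊢
    simp [← Finset.mul_sum, ha]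

/-- The space `V` in which the arrangements live. -/
abbrev V (n : ℕ) : Type := sumZero n

/-- The standard basis vector `ε_i` of `ℝⁿ`, with the `1`-based index `1 ≤ i ≤ n`. -/
noncomputable def stdVec (n i : ℕ) : Amb n :=
  WithLp.toLp 2 (fun x : Fin n => if (x : ℕ) + 1 = i then (1 : ℝ) else 0)

/-- The positive root `α_{ij} = α_i + ⋯ + α_j = ε_i - ε_{j+1}`, for `1 ≤ i ≤ j ≤ n - 1`.
The simple roots are the `α_{ii}`. -/
noncomputable def root (n i j : ℕ) : Amb n := stdVec n i - stdVec n (j + 1)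

/-- The highest root `θ = α_{1,n-1}`. -/
noncomputable def highestRoot (n : ℕ) : Amb n := root n 1 (n - 1)

/-- The hyperplane `H_{α,k} = {v ∈ V | ⟨v, α⟩ = k}`. -/
def hyperplane {n : ℕ} (α : Amb n) (k : ℤ) : Set (V n) :=
  {v | inner ℝ (v : Amb n) α = (k : ℝ)}

/-- The closed half-space `{v ∈ V | ⟨v, α⟩ ≥ k}`. -/
def halfGE {n : ℕ} (α : Amb n) (k : ℤ) : Set (V n) :=
  {v | (k : ℝ) ≤ inner ℝ (v : Amb n) α}

/-- The closed half-space `{v ∈ V | ⟨v, α⟩ ≤ k}`. -/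
def halfLE {n : ℕ} (α : Amb n) (k : ℤ) : Set (V n) :=
  {v | inner ℝ (v : Amb n) α ≤ (k : ℝ)}

/-- The `m`-Shi arrangement: all `H_{α,k}` with `α` a positive root and `-m < k ≤ m`. -/
def arrangement (n m : ℕ) : Set (Set (V n)) :=
  {H | ∃ i j : ℕ, 1 ≤ i ∧ i ≤ j ∧ j ≤ n - 1 ∧
    ∃ k : ℤ, -(m : ℤ) < k ∧ k ≤ (m : ℤ) ∧ H = hyperplane (root n i j) k}

/-- The complement in `V` of the union of the hyperplanes of the `m`-Shi arrangement. -/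
def arrCompl (n m : ℕ) : Set (V n) := (⋃₀ arrangement n m)ᶜ

/-- A region is a connected component of the complement of the arrangement. -/
def IsRegion (n m : ℕ) (R : Set (V n)) : Prop :=
  ∃ v ∈ arrCompl n m, R = connectedComponentIn (arrCompl n m) v

/-- The (closed) dominant chamber. -/
def dominantChamber (n : ℕ) : Set (V n) :=
  ⋂ i ∈ Set.Icc 1 (n - 1), halfGE (root n i i) 0

/-- The dominant regions of the `m`-Shi arrangement. -/
def dominantRegions (n m : ℕ) : Set (Set (V n)) :=
  {R | IsRegion n m R ∧ R ⊆ dominantChamber n}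

/-- The fundamental alcove `A₀`. -/
def fundAlcove (n : ℕ) : Set (V n) :=
  interior (halfLE (highestRoot n) 1 ∩ dominantChamber n)

/-- `R` and `S` lie in different closed half-spaces bounded by `H_{α,k}`. -/
def Separates {n : ℕ} (α : Amb n) (k : ℤ) (R S : Set (V n)) : Prop :=
  (R ⊆ halfGE α k ∧ S ⊆ halfLE α k) ∨ (R ⊆ halfLE α k ∧ S ⊆ halfGE α k)

/-- `H_{α,k}` is a wall of `R`: it belongs to the arrangement and supports a facet of `R`, i.e.
`R` lies on one side of it and `closure R ∩ H_{α,k}` is of full dimension in `H_{α,k}`. -/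
def IsWall (n m : ℕ) (α : Amb n) (k : ℤ) (R : Set (V n)) : Prop :=
  hyperplane α k ∈ arrangement n m ∧
  (R ⊆ halfGE α k ∨ R ⊆ halfLE α k) ∧
  (affineSpan ℝ (closure R ∩ hyperplane α k) : Set (V n)) = hyperplane α k

/-- A separating wall of `R` is a wall of `R` which separates `R` from `A₀`. -/
def IsSepWall (n m : ℕ) (α : Amb n) (k : ℤ) (R : Set (V n)) : Prop :=
  IsWall n m α k R ∧ Separates α k R (fundAlcove n)

/-- The dominant regions of the `m`-Shi arrangement having `H_{α,k}` as a separating wall. -/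
def sepSet (n m : ℕ) (α : Amb n) (k : ℤ) : Set (Set (V n)) :=
  {R | R ∈ dominantRegions n m ∧ IsSepWall n m α k R}

/-- `r(R)`: the number of pairs `(j,k)` with `1 ≤ j ≤ n - 1`, `1 ≤ k ≤ m` such that
`H_{α_{1j},k}` separates `R` from `A₀`. -/
noncomputable def rStat (n m : ℕ) (R : Set (V n)) : ℕ :=
  Set.ncard {x : ℕ × ℕ | (1 ≤ x.1 ∧ x.1 ≤ n - 1) ∧ (1 ≤ x.2 ∧ x.2 ≤ m) ∧
    Separates (root n 1 x.1) (x.2 : ℤ) R (fundAlcove n)}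

/-- `c(R)`: the number of pairs `(i,k)` with `1 ≤ i ≤ n - 1`, `1 ≤ k ≤ m` such that
`H_{α_{i,n-1},k}` separates `R` from `A₀`. -/
noncomputable def cStat (n m : ℕ) (R : Set (V n)) : ℕ :=
  Set.ncard {x : ℕ × ℕ | (1 ≤ x.1 ∧ x.1 ≤ n - 1) ∧ (1 ≤ x.2 ∧ x.2 ≤ m) ∧
    Separates (root n x.1 (n - 1)) (x.2 : ℤ) R (fundAlcove n)}

/-- The generating function `F^n_{α,m}(p,q)`, the sum of `p^{c(R)} q^{r(R)}` over the dominant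
regions `R` of the `m`-Shi arrangement having `H_{α,m}` as a separating wall. -/
noncomputable def genFun {A : Type*} [CommSemiring A] (n m : ℕ) (α : Amb n) (p q : A) : A :=
  ∑ᶠ R ∈ sepSet n m α (m : ℤ), p ^ cStat n m R * q ^ rStat n m R

/-- `[k]_{p,q} = ∑_{j=0}^{k-1} p^j q^{k-1-j}`. -/
def pqInt {A : Type*} [CommSemiring A] (k : ℕ) (p q : A) : A :=
  ∑ j ∈ Finset.range k, p ^ j * q ^ (k - 1 - j)

end Shi

/-!
Every dominant region with separating wall `H_{θ,m}` is the chamber on the positive side of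
`H_{θ,m}` next to a dominant point `u` of that hyperplane lying on no other hyperplane of the
arrangement. Dominance and `⟨u, θ⟩ = m` force `0 ≤ ⟨u, α⟩ ≤ m` for every positive root `α`, so the
chamber is determined by the integer parts of the `⟨u, α⟩`. Put `x_t = ⟨u, α_{1,t}⟩` for
`1 ≤ t ≤ n - 2`. These numbers increase with `t`, lie strictly between `0` and `m`, and have
distinct nonzero fractional parts, and the integer parts of all `⟨u, α⟩` are determined by those of
the `x_t` and by the order of the fractional parts of the `x_t`. Listing the integer parts in the
order of the fractional parts gives a word `w` of length `n - 2` in the letters `0, …, m - 1`;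
conversely `w` determines both data, because sorting the positions of `w` stably by their letters
puts the `x_t` back in increasing order. Finally `r(R)` and `c(R)` are the sums of the integer parts
of the `⟨u, α_{1,j}⟩` and of the `⟨u, α_{i,n-1}⟩`, that is `m + ∑ w_s` and `m + ∑ (m - 1 - w_s)`.
-/

namespace Shi

open Set Filter Topology

section Polyhedra

variable {ι E : Type*} [AddCommGroup E] [Module ℝ E]

lemma exists_forall_pos_of_concaveOn [Finite ι] {C : Set E} (hC : C.Nonempty) {g : ι → E → ℝ}
    (hg : ∀ i, ConcaveOn ℝ C (g i)) (hnonneg : ∀ i, ∀ x ∈ C, 0 ≤ g i x)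
    (hpos : ∀ i, ∃ x ∈ C, 0 < g i x) : ∃ x ∈ C, ∀ i, 0 < g i x := by
  cases nonempty_fintype ι
  rcases isEmpty_or_nonempty ι with hι | hι
  · exact hC.imp fun x hx => ⟨hx, isEmptyElim⟩
  choose x hxC hx using hpos
  have hw : 0 < ∑ _i : ι, (1 : ℝ) := by simp [Fintype.card_pos]
  refine ⟨Finset.univ.centerMass (fun _ => 1) x, (hg hι.some).1.centerMass_mem
    (fun _ _ => zero_le_one) hw fun i _ => hxC i, fun i => ?_⟩
  calc 0 < Finset.univ.centerMass (fun _ => (1 : ℝ)) (g i ∘ x) := by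
        refine smul_pos (inv_pos.2 hw) (Finset.sum_pos' (fun j _ => ?_) ⟨i, Finset.mem_univ i, ?_⟩)
        · simpa using hnonneg i _ (hxC j)
        · simpa using hx i
    _ ≤ g i (Finset.univ.centerMass (fun _ => 1) x) :=
        (hg i).le_map_centerMass (fun _ _ => zero_le_one) hw fun j _ => hxC j

/-- The zero locus of an affine functional, which is a hyperplane unless the functional is
constant. -/
def zeroLocus (g : E →ᵃ[ℝ] ℝ) : AffineSubspace ℝ E := (AffineSubspace.mk' 0 ⊥).comap g

@[simp] lemma mem_zeroLocus {g : E →ᵃ[ℝ] ℝ} {x : E} : x ∈ zeroLocus g ↔ g x = 0 := by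
  simp [zeroLocus]

variable [TopologicalSpace E]

/-- The open polyhedron of the points satisfying all the strict inequalities `0 < g i x`. -/
def openPolyhedron (g : ι → E →ᴬ[ℝ] ℝ) : Set E := {x | ∀ i, 0 < g i x}

/-- The face of the polyhedron of `g` lying on the zero locus of `g i₀`. -/
def facet (g : ι → E →ᴬ[ℝ] ℝ) (i₀ : ι) : Set E :=
  closure (openPolyhedron g) ∩ zeroLocus (g i₀ : E →ᵃ[ℝ] ℝ)

/-- The points of the zero locus of `g i₀` satisfying all the other inequalities strictly. -/
def facetInterior (g : ι → E →ᴬ[ℝ] ℝ) (i₀ : ι) : Set E := {x | g i₀ x = 0 ∧ ∀ i ≠ i₀, 0 < g i x}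

variable {g : ι → E →ᴬ[ℝ] ℝ} {i₀ : ι}

lemma convex_openPolyhedron : Convex ℝ (openPolyhedron g) := by
  simp only [openPolyhedron, ofPred_forall]
  exact convex_iInter fun i => (convex_Ioi 0).affine_preimage (g i : E →ᵃ[ℝ] ℝ)

lemma closure_openPolyhedron_subset : closure (openPolyhedron g) ⊆ {x | ∀ i, 0 ≤ g i x} := by
  refine closure_minimal (fun x hx i => (hx i).le) ?_
  simp only [ofPred_forall]
  exact isClosed_iInter fun i => isClosed_le continuous_const (g i).continuous

lemma setOf_forall_ne_pos_mem_nhds [Finite ι] {x : E} (hx : ∀ i ≠ i₀, 0 < g i x) :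
    {y | ∀ i ≠ i₀, 0 < g i y} ∈ 𝓝 x := by
  refine eventually_all.2 fun i => ?_
  by_cases hi : i = i₀
  · exact Eventually.of_forall fun y h => absurd hi h
  · exact ((g i).continuous.continuousAt.eventually_const_lt (hx i hi)).mono fun y hy _ => hy

variable [IsTopologicalAddGroup E] [ContinuousSMul ℝ E]

lemma closure_openPolyhedron (hne : (openPolyhedron g).Nonempty) :
    closure (openPolyhedron g) = {x | ∀ i, 0 ≤ g i x} := by
  refine closure_openPolyhedron_subset.antisymm fun x hx => ?_
  obtain ⟨y, hy⟩ := hne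
  refine closure_mono ?_ (segment_subset_closure_openSegment (left_mem_segment ℝ x y))
  rw [openSegment_eq_image_lineMap]
  rintro _ ⟨t, ⟨ht0, ht1⟩, rfl⟩ i
  rw [ContinuousAffineMap.apply_lineMap, AffineMap.lineMap_apply_ring]
  exact add_pos_of_nonneg_of_pos (mul_nonneg (sub_nonneg.2 ht1.le) (hx i)) (mul_pos ht0 (hy i))

lemma eventually_lineMap_mem {x : E} {s : Set E} (hs : s ∈ 𝓝 x) (y : E) :
    ∀ᶠ t : ℝ in 𝓝[>] 0, AffineMap.lineMap x y t ∈ s := by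
  have hlim : Tendsto (AffineMap.lineMap x y : ℝ → E) (𝓝 0) (𝓝 x) := by
    simpa using (AffineMap.lineMap_continuous (p := x) (q := y)).tendsto (0 : ℝ)
  exact (hlim.mono_left nhdsWithin_le_nhds) hs

lemma affineSpan_inter_of_mem_nhds {H : AffineSubspace ℝ E} {x : E} {s : Set E} (hx : x ∈ H)
    (hs : s ∈ 𝓝 x) : affineSpan ℝ (s ∩ H) = H := by
  refine le_antisymm (affineSpan_le.2 inter_subset_right) fun y hy => ?_
  obtain ⟨t, ht, htpos⟩ := ((eventually_lineMap_mem hs y).and self_mem_nhdsWithin).exists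
  have hx_span : x ∈ affineSpan ℝ (s ∩ H) := subset_affineSpan ℝ _ ⟨mem_of_mem_nhds hs, hx⟩
  have hz_span : AffineMap.lineMap x y t ∈ affineSpan ℝ (s ∩ H) :=
    subset_affineSpan ℝ _ ⟨ht, AffineMap.lineMap_mem t hx hy⟩
  have hy_eq : AffineMap.lineMap x (AffineMap.lineMap x y t) t⁻¹ = y := by
    rw [AffineMap.lineMap_lineMap_right, inv_mul_cancel₀ (ne_of_gt htpos),
      AffineMap.lineMap_apply_one]
  exact hy_eq ▸ AffineMap.lineMap_mem t⁻¹ hx_span hz_span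

lemma openPolyhedron_nonempty [Finite ι] (hpos : ∃ y, 0 < g i₀ y)
    (hne : (facetInterior g i₀).Nonempty) : (openPolyhedron g).Nonempty := by
  obtain ⟨y, hy⟩ := hpos
  obtain ⟨x, hx₀, hx⟩ := hne
  obtain ⟨t, ht, htpos⟩ := ((eventually_lineMap_mem (setOf_forall_ne_pos_mem_nhds hx) y).and
    self_mem_nhdsWithin).exists
  refine ⟨AffineMap.lineMap x y t, fun i => ?_⟩
  rcases eq_or_ne i i₀ with rfl | hi
  · rw [ContinuousAffineMap.apply_lineMap, AffineMap.lineMap_apply_ring, hx₀, mul_zero, zero_add]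
    exact mul_pos htpos hy
  · exact ht i hi

lemma affineSpan_facet_of_facetInterior_nonempty [Finite ι] (hpos : ∃ y, 0 < g i₀ y)
    (hne : (facetInterior g i₀).Nonempty) : affineSpan ℝ (facet g i₀) = zeroLocus (g i₀) := by
  have hfacet : facet g i₀ = {y | ∀ i ≠ i₀, 0 ≤ g i y} ∩ zeroLocus (g i₀ : E →ᵃ[ℝ] ℝ) := by
    rw [facet, closure_openPolyhedron (openPolyhedron_nonempty hpos hne)]
    ext y
    refine and_congr_left fun hy => ⟨fun h i _ => h i, fun h i => ?_⟩
    rcases eq_or_ne i i₀ with rfl | hi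
    · exact (mem_zeroLocus.1 hy).ge
    · exact h i hi
  obtain ⟨x, hx₀, hx⟩ := hne
  rw [hfacet]
  exact affineSpan_inter_of_mem_nhds (mem_zeroLocus.2 hx₀)
    (mem_of_superset (setOf_forall_ne_pos_mem_nhds hx) fun y hy i hi => (hy i hi).le)

/-- No other inequality is tight on the whole facet, because the facet spans a hyperplane on which
the other functionals do not vanish identically; averaging points of the facet does the rest. -/
lemma facetInterior_nonempty_of_affineSpan_facet [Finite ι]
    (hgen : ∃ x, g i₀ x = 0 ∧ ∀ i ≠ i₀, g i x ≠ 0)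
    (hspan : affineSpan ℝ (facet g i₀) = zeroLocus (g i₀)) : (facetInterior g i₀).Nonempty := by
  obtain ⟨x₀, hx₀, hx₀ne⟩ := hgen
  have hx₀span : x₀ ∈ affineSpan ℝ (facet g i₀) := hspan ▸ mem_zeroLocus.2 hx₀
  have hnonneg : ∀ i, ∀ x ∈ facet g i₀, 0 ≤ g i x := fun i x hx =>
    closure_openPolyhedron_subset hx.1 i
  have hexists_pos : ∀ i : {i // i ≠ i₀}, ∃ x ∈ facet g i₀, 0 < g i x := by
    rintro ⟨i, hi⟩
    by_contra! hle
    have hspan_le : affineSpan ℝ (facet g i₀) ≤ zeroLocus (g i) :=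
      affineSpan_le.2 fun x hx => mem_zeroLocus.2 ((hle x hx).antisymm (hnonneg i x hx))
    exact hx₀ne i hi (mem_zeroLocus.1 (hspan_le hx₀span))
  have hconcave : ∀ i : {i // i ≠ i₀}, ConcaveOn ℝ (facet g i₀) (g i) := fun i =>
    ((concaveOn_id convex_univ).comp_affineMap (g i : E →ᵃ[ℝ] ℝ)).subset (subset_univ _)
      (convex_openPolyhedron.closure.inter (zeroLocus _).convex)
  obtain ⟨x, hxC, hx⟩ := exists_forall_pos_of_concaveOn
    ((affineSpan_nonempty ℝ).1 ⟨x₀, hx₀span⟩) hconcave (fun i => hnonneg i) hexists_pos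
  exact ⟨x, mem_zeroLocus.1 hxC.2, fun i hi => hx ⟨i, hi⟩⟩

end Polyhedra

section Arrangements

lemma nonneg_iff_of_isPreconnected {X : Type*} [TopologicalSpace X] {S : Set X}
    (hS : IsPreconnected S) {f : X → ℝ} (hf : ContinuousOn f S) (hne : ∀ x ∈ S, f x ≠ 0) {x y : X}
    (hx : x ∈ S) (hy : y ∈ S) : 0 ≤ f x ↔ 0 ≤ f y := by
  have himp : ∀ x ∈ S, ∀ y ∈ S, 0 ≤ f x → 0 ≤ f y := by
    intro x hx y hy hfx
    by_contra! hfy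
    obtain ⟨z, hz, hfz⟩ := hS.intermediate_value hy hx hf ⟨hfy.le, hfx⟩
    exact hne z hz hfz
  exact ⟨himp x hx y hy, himp y hy x hx⟩

variable {ι E : Type*} [AddCommGroup E] [Module ℝ E] [TopologicalSpace E]

/-- The complement of the arrangement of the zero loci of the `f i`. -/
def complement (f : ι → E →ᴬ[ℝ] ℝ) : Set E := {v | ∀ i, f i v ≠ 0}

/-- The functional `f i` with the sign that makes it nonnegative at `u`. -/
noncomputable def orient (f : ι → E →ᴬ[ℝ] ℝ) (u : E) (i : ι) : E →ᴬ[ℝ] ℝ :=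
  if 0 ≤ f i u then f i else -f i

/-- The points on the same side as `u` of every zero locus of `f`, where a `u` on a zero locus
counts as being on its positive side. For `u` in the complement this is the chamber containing `u`;
for `u` on a single zero locus it is the chamber next to `u` on the positive side. -/
def chamber (f : ι → E →ᴬ[ℝ] ℝ) (u : E) : Set E := openPolyhedron (orient f u)

/-- The point `u` lies on the zero locus of `f i₀` and on no other one. -/
def IsGenericOn (f : ι → E →ᴬ[ℝ] ℝ) (i₀ : ι) (u : E) : Prop := f i₀ u = 0 ∧ ∀ i ≠ i₀, f i u ≠ 0

variable {f : ι → E →ᴬ[ℝ] ℝ} {i i₀ : ι} {u v : E}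

lemma orient_eq_zero_iff : orient f u i v = 0 ↔ f i v = 0 := by
  unfold orient
  split_ifs <;> simp

lemma orient_pos_iff : 0 < orient f u i v ↔ f i v ≠ 0 ∧ (0 ≤ f i v ↔ 0 ≤ f i u) := by
  unfold orient
  split_ifs with h
  · simp only [h, iff_true, lt_iff_le_and_ne, ne_comm, and_comm]
  · simp only [h, iff_false, ContinuousAffineMap.neg_apply, Left.neg_pos_iff, not_le]
    exact ⟨fun hv => ⟨hv.ne, hv⟩, And.right⟩

lemma mem_chamber_iff :
    v ∈ chamber f u ↔ v ∈ complement f ∧ ∀ i, (0 ≤ f i v ↔ 0 ≤ f i u) := by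
  simp only [chamber, openPolyhedron, mem_ofPred_eq, orient_pos_iff, forall_and, complement]

lemma mem_chamber_self (hu : u ∈ complement f) : u ∈ chamber f u :=
  mem_chamber_iff.2 ⟨hu, fun _ => Iff.rfl⟩

lemma chamber_subset_complement : chamber f u ⊆ complement f := fun _ hv => (mem_chamber_iff.1 hv).1

lemma chamber_congr (h : ∀ i, 0 ≤ f i u ↔ 0 ≤ f i v) : chamber f u = chamber f v := by
  ext w
  simp only [mem_chamber_iff, h]

lemma chamber_eq_of_mem (hv : v ∈ chamber f u) : chamber f v = chamber f u :=
  chamber_congr (mem_chamber_iff.1 hv).2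

lemma nonneg_iff_of_chamber_eq (hne : (chamber f u).Nonempty) (h : chamber f u = chamber f v)
    (i : ι) : 0 ≤ f i u ↔ 0 ≤ f i v := by
  obtain ⟨w, hw⟩ := hne
  exact ((mem_chamber_iff.1 hw).2 i).symm.trans ((mem_chamber_iff.1 (h ▸ hw)).2 i)

lemma IsGenericOn.mem_facetInterior (hu : IsGenericOn f i₀ u) :
    u ∈ facetInterior (orient f u) i₀ :=
  ⟨orient_eq_zero_iff.2 hu.1, fun i hi => orient_pos_iff.2 ⟨hu.2 i hi, Iff.rfl⟩⟩

variable [IsTopologicalAddGroup E] [ContinuousSMul ℝ E]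

lemma connectedComponentIn_complement (hv : v ∈ complement f) :
    connectedComponentIn (complement f) v = chamber f v := by
  refine Subset.antisymm (fun w hw => ?_)
    (convex_openPolyhedron.isPreconnected.subset_connectedComponentIn (mem_chamber_self hv)
      chamber_subset_complement)
  have hsub := connectedComponentIn_subset (complement f) v
  exact mem_chamber_iff.2 ⟨hsub hw, fun i =>
    nonneg_iff_of_isPreconnected isPreconnected_connectedComponentIn (f i).continuous.continuousOn
      (fun x hx => hsub hx i) hw (mem_connectedComponentIn hv)⟩

lemma IsGenericOn.chamber_nonempty [Finite ι] (hpos : ∃ y, 0 < f i₀ y)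
    (hu : IsGenericOn f i₀ u) : (chamber f u).Nonempty := by
  refine openPolyhedron_nonempty (i₀ := i₀) ?_ ⟨u, hu.mem_facetInterior⟩
  simpa only [orient, hu.1.ge, if_true] using hpos

lemma affineSpan_facet_orient_eq_iff [Finite ι] (hpos : ∃ y, 0 < f i₀ y)
    (hgen : ∃ u, IsGenericOn f i₀ u) (hv : 0 ≤ f i₀ v) :
    affineSpan ℝ (facet (orient f v) i₀) = zeroLocus (f i₀) ↔
      ∃ u, IsGenericOn f i₀ u ∧ chamber f u = chamber f v := by
  have hor : orient f v i₀ = f i₀ := if_pos hv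
  rw [← hor]
  constructor
  · intro hspan
    have hgen' : ∃ u, orient f v i₀ u = 0 ∧ ∀ i ≠ i₀, orient f v i u ≠ 0 := by
      simpa only [IsGenericOn, ne_eq, orient_eq_zero_iff] using hgen
    obtain ⟨u, hu₀, hu⟩ := facetInterior_nonempty_of_affineSpan_facet hgen' hspan
    rw [orient_eq_zero_iff] at hu₀
    simp only [orient_pos_iff] at hu
    refine ⟨u, ⟨hu₀, fun i hi => (hu i hi).1⟩, chamber_congr fun i => ?_⟩
    rcases eq_or_ne i i₀ with rfl | hi
    · simp only [hu₀, le_rfl, hv]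
    · exact (hu i hi).2
  · rintro ⟨u, hu, huv⟩
    have horient : orient f u = orient f v := by
      funext i
      simp only [orient, nonneg_iff_of_chamber_eq (hu.chamber_nonempty hpos) huv i]
    exact affineSpan_facet_of_facetInterior_nonempty (hor ▸ hpos)
      ⟨u, horient ▸ hu.mem_facetInterior⟩

end Arrangements

section FractionalParts

variable {R : Type*} [Ring R] [LinearOrder R] [IsStrictOrderedRing R] [FloorRing R]

lemma floor_sub_eq (x y : R) :
    ⌊x - y⌋ = ⌊x⌋ - ⌊y⌋ - if Int.fract x < Int.fract y then 1 else 0 := by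
  have hsub : x - y = ((⌊x⌋ - ⌊y⌋ : ℤ) : R) + (Int.fract x - Int.fract y) := by
    simp only [Int.fract, Int.cast_sub]
    abel
  rw [hsub, Int.floor_intCast_add, sub_eq_add_neg _ (ite _ _ _), add_right_inj, Int.floor_eq_iff]
  split_ifs with h
  · have hle : Int.fract y ≤ Int.fract x + 1 :=
      (Int.fract_lt_one y).le.trans (le_add_of_nonneg_left (Int.fract_nonneg x))
    simpa [h, add_comm] using hle
  · have hlt : Int.fract x < Int.fract y + 1 :=
      (Int.fract_lt_one x).trans_le (le_add_of_nonneg_left (Int.fract_nonneg y))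
    simpa [sub_lt_iff_lt_add', not_lt.1 h, add_comm] using hlt

lemma fract_sub_pos_iff {x y : R} : 0 < Int.fract (x - y) ↔ Int.fract x ≠ Int.fract y := by
  rw [(Int.fract_nonneg _).lt_iff_ne', ne_eq, Int.fract_eq_zero_iff, ne_eq, Int.fract_eq_fract]
  simp only [mem_range, eq_comm]

end FractionalParts

section Permutations

lemma equiv_eq_of_inversions_iff {α β : Type*} [LinearOrder α] [LinearOrder β] [WellFoundedLT β]
    {σ τ : α ≃ β} (h : ∀ s t, s < t → (σ t < σ s ↔ τ t < τ s)) : σ = τ := by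
  have hmono : StrictMono (σ.symm.trans τ) := fun i j hij => by
    obtain ⟨s, rfl⟩ := σ.surjective i
    obtain ⟨t, rfl⟩ := σ.surjective j
    simp only [Equiv.trans_apply, Equiv.symm_apply_apply]
    rcases lt_trichotomy s t with hst | rfl | hts
    · exact (not_lt.1 ((h s t hst).not.1 hij.not_gt)).lt_of_ne (τ.injective.ne hst.ne)
    · exact absurd hij (lt_irrefl _)
    · exact (h t s hts).1 hij
  have hrefl : hmono.orderIsoOfSurjective _ (σ.symm.trans τ).surjective = OrderIso.refl β :=
    Subsingleton.elim _ _
  ext t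
  simpa using (DFunLike.congr_fun hrefl (σ t)).symm

lemma sort_symm_lt_sort_symm_iff {α : Type*} [LinearOrder α] {N : ℕ} {f : Fin N → α}
    (hf : Function.Injective f) {s t : Fin N} :
    (Tuple.sort f).symm s < (Tuple.sort f).symm t ↔ f s < f t := by
  have hmono : StrictMono (f ∘ Tuple.sort f) :=
    (Tuple.monotone_sort f).strictMono_of_injective (hf.comp (Tuple.sort f).injective)
  simpa using (hmono.lt_iff_lt (a := (Tuple.sort f).symm s) (b := (Tuple.sort f).symm t)).symm

end Permutations

section Gaps

variable {n : ℕ}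

/-- The root `ε_a - ε_b` as a functional on `V`. -/
noncomputable def gap (a b : Fin n) : V n →L[ℝ] ℝ :=
  ((EuclideanSpace.proj a : Amb n →L[ℝ] ℝ) - EuclideanSpace.proj b).comp (sumZero n).subtypeL

lemma gap_apply (a b : Fin n) (v : V n) : gap a b v = (v : Amb n) a - (v : Amb n) b := rfl

@[simp] lemma gap_self (a : Fin n) (v : V n) : gap a a v = 0 := sub_self _

lemma gap_sub_gap_left (a b c : Fin n) (v : V n) : gap a c v - gap a b v = gap b c v :=
  sub_sub_sub_cancel_left _ _ _

lemma inner_root (v : V n) (a b : Fin n) : inner ℝ (v : Amb n) (root n (a + 1) b) = gap a b v := by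
  have hstd : ∀ c : Fin n, inner ℝ (v : Amb n) (stdVec n (c + 1)) = (v : Amb n) c := fun c => by
    simp [stdVec, PiLp.inner_apply, Fin.val_inj]
  rw [root, inner_sub_right, hstd, hstd, gap_apply]

lemma highestRoot_eq_root (n : ℕ) :
    highestRoot (n + 1) = root (n + 1) ((0 : Fin (n + 1)) + 1) (Fin.last n) := by
  simp [highestRoot]

/-- The orthogonal projection of `x` to `V`. -/
noncomputable def centre (x : Fin n → ℝ) : V n :=
  ⟨WithLp.toLp 2 fun a => x a - (∑ b, x b) / n, by
    rcases eq_or_ne n 0 with rfl | hn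
    · simp [sumZero]
    · have hn' : (n : ℝ) ≠ 0 := Nat.cast_ne_zero.2 hn
      simp [sumZero, mul_div_cancel₀ _ hn']⟩

@[simp] lemma gap_centre (x : Fin n → ℝ) (a b : Fin n) : gap a b (centre x) = x a - x b :=
  sub_sub_sub_cancel_right _ _ _

lemma mem_dominantChamber_iff {v : V n} :
    v ∈ dominantChamber n ↔ ∀ a b : Fin n, a ≤ b → 0 ≤ gap a b v := by
  simp only [dominantChamber, mem_iInter, halfGE, mem_ofPred_eq, Int.cast_zero]
  constructor
  · rcases n with _ | n
    · exact fun _ a => a.elim0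
    intro h a b hab
    have hanti : Antitone fun c => (v : Amb (n + 1)) c := Fin.antitone_iff_succ_le.2 fun c => by
      have hc := h (c.castSucc + 1) ⟨by simp, by simp⟩
      rw [show root (n + 1) (c.castSucc + 1) (c.castSucc + 1) = root (n + 1) (c.castSucc + 1) c.succ
        from rfl, inner_root] at hc
      exact sub_nonneg.1 hc
    exact sub_nonneg.2 (hanti hab)
  · rintro h i ⟨hi, hin⟩
    obtain ⟨j, rfl⟩ := Nat.exists_eq_add_of_le' hi
    rw [show root n (j + 1) (j + 1) = root n ((⟨j, by lia⟩ : Fin n) + 1) (⟨j + 1, by lia⟩ : Fin n)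
      from rfl, inner_root]
    exact h _ _ (Fin.mk_le_mk.2 j.le_succ)

lemma gap_le_gap {v : V n} (hv : v ∈ dominantChamber n) {a b c d : Fin n} (hca : c ≤ a)
    (hbd : b ≤ d) : gap a b v ≤ gap c d v := by
  have hca' := mem_dominantChamber_iff.1 hv c a hca
  have hbd' := mem_dominantChamber_iff.1 hv b d hbd
  simp only [gap_apply] at hca' hbd' ⊢
  linarith

lemma gap_le_one_of_mem_fundAlcove {v : V (n + 1)} (hv : v ∈ fundAlcove (n + 1))
    (a b : Fin (n + 1)) : gap a b v ≤ 1 := by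
  obtain ⟨hθ, hdom⟩ := interior_subset hv
  rw [halfLE, mem_ofPred_eq, highestRoot_eq_root, inner_root, Int.cast_one] at hθ
  exact (gap_le_gap hdom (Fin.zero_le a) (Fin.le_last b)).trans hθ

lemma exists_mem_fundAlcove (n : ℕ) :
    ∃ v ∈ fundAlcove (n + 1), ∀ a b : Fin (n + 1), gap a b v < 1 := by
  set v : V (n + 1) := centre fun a => -(a : ℝ) / (n + 1) with hv
  have hgap : ∀ a b, gap a b v = ((b : ℝ) - a) / (n + 1) := fun a b => by
    rw [hv, gap_centre]
    ring
  have hpos : ∀ a b, a < b → 0 < gap a b v := fun a b hab => by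
    rw [hgap]
    exact div_pos (sub_pos.2 (by exact_mod_cast hab)) (by positivity)
  have hlt : ∀ a b, gap a b v < 1 := fun a b => by
    rw [hgap, div_lt_one (by positivity)]
    have hb : (b : ℝ) < n + 1 := by exact_mod_cast b.2
    linarith [(a : ℕ).cast_nonneg (α := ℝ)]
  refine ⟨v, mem_interior_iff_mem_nhds.2 ?_, hlt⟩
  have hθ : ∀ᶠ w in 𝓝 v, gap 0 (Fin.last n) w < 1 :=
    (gap _ _).continuous.continuousAt.eventually_lt_const (hlt _ _)
  have hdom : ∀ᶠ w in 𝓝 v, ∀ a b, a < b → 0 < gap a b w :=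
    eventually_all.2 fun a => eventually_all.2 fun b => eventually_imp_distrib_left.2 fun hab =>
      (gap a b).continuous.continuousAt.eventually_const_lt (hpos a b hab)
  filter_upwards [hθ, hdom] with w hwθ hw
  refine ⟨?_, mem_dominantChamber_iff.2 fun a b hab => ?_⟩
  · rw [halfLE, mem_ofPred_eq, highestRoot_eq_root, inner_root, Int.cast_one]
    exact hwθ.le
  · rcases hab.eq_or_lt with rfl | hab
    · simp
    · exact (hw a b hab).le

lemma separates_fundAlcove_iff {a b : Fin (n + 1)} {k : ℤ} (hk : 1 ≤ k) {R : Set (V (n + 1))} :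
    Separates (root (n + 1) (a + 1) b) k R (fundAlcove (n + 1)) ↔ ∀ v ∈ R, (k : ℝ) ≤ gap a b v := by
  have hk' : (1 : ℝ) ≤ k := by exact_mod_cast hk
  simp only [Separates, halfGE, halfLE, inner_root, subset_def, mem_ofPred_eq]
  refine ⟨?_, fun h => Or.inl ⟨h, fun v hv => (gap_le_one_of_mem_fundAlcove hv a b).trans hk'⟩⟩
  rintro (⟨hR, -⟩ | ⟨-, hA⟩)
  · exact hR
  · obtain ⟨v, hv, hlt⟩ := exists_mem_fundAlcove n
    exact absurd (hk'.trans (hA v hv)) (hlt a b).not_ge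

end Gaps

section ShiArrangement

variable {n m : ℕ}

/-- The triples `(a, b, k)` with `a < b` and `-m < k ≤ m`, which index the hyperplanes of the
`m`-Shi arrangement. -/
abbrev ShiIndex (n m : ℕ) : Type := {ab : Fin n × Fin n // ab.1 < ab.2} × Ioc (-(m : ℤ)) m

/-- The functional `gap a b - k`, which vanishes on the hyperplane indexed by `(a, b, k)`. -/
noncomputable def shiForm (i : ShiIndex n m) : V n →ᴬ[ℝ] ℝ :=
  (gap i.1.1.1 i.1.1.2).toContinuousAffineMap - ContinuousAffineMap.const ℝ _ (i.2 : ℝ)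

/-- The chamber of the `m`-Shi arrangement at `u`, in the sense of `chamber`. -/
abbrev shiChamber (m : ℕ) (u : V n) : Set (V n) := chamber (shiForm (m := m)) u

lemma shiForm_nonneg_iff {i : ShiIndex n m} {v : V n} :
    0 ≤ shiForm i v ↔ ((i.2 : ℤ) : ℝ) ≤ gap i.1.1.1 i.1.1.2 v := sub_nonneg

lemma shiForm_eq_zero_iff {i : ShiIndex n m} {v : V n} :
    shiForm i v = 0 ↔ gap i.1.1.1 i.1.1.2 v = (i.2 : ℤ) := sub_eq_zero

lemma coe_zeroLocus_shiForm (i : ShiIndex n m) :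
    (zeroLocus (shiForm i : V n →ᵃ[ℝ] ℝ) : Set (V n)) =
      hyperplane (root n (i.1.1.1 + 1) i.1.1.2) i.2 := by
  ext v
  simp [hyperplane, inner_root, shiForm_eq_zero_iff]

lemma mem_arrangement_iff {H : Set (V n)} : H ∈ arrangement n m ↔
    ∃ i : ShiIndex n m, H = hyperplane (root n (i.1.1.1 + 1) i.1.1.2) i.2 := by
  constructor
  · rintro ⟨a, b, ha, hab, hb, k, hk, hkm, rfl⟩
    obtain ⟨a, rfl⟩ := Nat.exists_eq_add_of_le' ha
    exact ⟨(⟨(⟨a, by lia⟩, ⟨b, by lia⟩), hab⟩, ⟨k, hk, hkm⟩), rfl⟩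
  · rintro ⟨⟨⟨⟨a, b⟩, hab⟩, ⟨k, hk, hkm⟩⟩, rfl⟩
    have hab' : (a : ℕ) < b := hab
    exact ⟨a + 1, b, by lia, hab', by lia, k, hk, hkm, rfl⟩

lemma arrCompl_eq_complement : arrCompl n m = complement (shiForm (n := n) (m := m)) := by
  ext v
  simp only [arrCompl, complement, mem_compl_iff, mem_sUnion, mem_arrangement_iff,
    ← coe_zeroLocus_shiForm]
  simp

lemma isRegion_iff {R : Set (V n)} :
    IsRegion n m R ↔ ∃ u, (shiChamber m u).Nonempty ∧ R = shiChamber m u := by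
  rw [IsRegion, arrCompl_eq_complement]
  constructor
  · rintro ⟨v, hv, rfl⟩
    exact ⟨v, ⟨v, mem_chamber_self hv⟩, connectedComponentIn_complement hv⟩
  · rintro ⟨u, ⟨v, hv⟩, rfl⟩
    have hv' := chamber_subset_complement hv
    exact ⟨v, hv', by rw [connectedComponentIn_complement hv', chamber_eq_of_mem hv]⟩

lemma chamber_subset_dominantChamber_iff (hm : 1 ≤ m) {u : V n}
    (hne : (shiChamber m u).Nonempty) :
    shiChamber m u ⊆ dominantChamber n ↔ u ∈ dominantChamber n := by
  have hiff : ∀ v ∈ shiChamber m u,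
      v ∈ dominantChamber n ↔ u ∈ dominantChamber n := fun v hv => by
    simp only [mem_dominantChamber_iff]
    refine forall₃_congr fun a b hab => ?_
    rcases hab.eq_or_lt with rfl | hab
    · simp
    · simpa only [shiForm_nonneg_iff, Int.cast_zero] using
        (mem_chamber_iff.1 hv).2 (⟨(a, b), hab⟩, ⟨0, by lia, by lia⟩)
  obtain ⟨v, hv⟩ := hne
  exact ⟨fun h => (hiff v hv).1 (h hv), fun hu w hw => (hiff w hw).2 hu⟩

lemma separates_shiChamber_iff {u : V (n + 1)} (hne : (shiChamber m u).Nonempty)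
    {i : ShiIndex (n + 1) m} (hk : 1 ≤ (i.2 : ℤ)) :
    Separates (root (n + 1) (i.1.1.1 + 1) i.1.1.2) i.2 (shiChamber m u) (fundAlcove (n + 1)) ↔
      ((i.2 : ℤ) : ℝ) ≤ gap i.1.1.1 i.1.1.2 u := by
  rw [separates_fundAlcove_iff hk]
  have hiff : ∀ v ∈ shiChamber m u, ((i.2 : ℤ) : ℝ) ≤ gap i.1.1.1 i.1.1.2 v ↔
      ((i.2 : ℤ) : ℝ) ≤ gap i.1.1.1 i.1.1.2 u := fun v hv => by
    simpa only [shiForm_nonneg_iff] using (mem_chamber_iff.1 hv).2 i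
  obtain ⟨v, hv⟩ := hne
  exact ⟨fun h => (hiff v hv).1 (h v hv), fun hu w hw => (hiff w hw).2 hu⟩

lemma exists_shiForm_pos (i : ShiIndex n m) : ∃ y, 0 < shiForm i y := by
  obtain ⟨⟨⟨a, b⟩, hab⟩, k⟩ := i
  refine ⟨centre (Pi.single a (k + 1 : ℝ)), sub_pos.2 ?_⟩
  change ((k : ℤ) : ℝ) < gap a b _
  simp [(ne_of_lt hab).symm]

lemma facet_shiForm {i : ShiIndex n m} {u : V n} (hu : 0 ≤ shiForm i u) :
    facet (orient shiForm u) i =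
      closure (shiChamber m u) ∩ hyperplane (root n (i.1.1.1 + 1) i.1.1.2) i.2 := by
  rw [facet, orient, if_pos hu, coe_zeroLocus_shiForm, shiChamber, chamber]

lemma isSepWall_shiChamber_iff {i : ShiIndex (n + 1) m} (hk : 1 ≤ (i.2 : ℤ))
    (hgen : ∃ u : V (n + 1), IsGenericOn shiForm i u) {v : V (n + 1)}
    (hne : (shiChamber m v).Nonempty) :
    IsSepWall (n + 1) m (root (n + 1) (i.1.1.1 + 1) i.1.1.2) i.2 (shiChamber m v) ↔
      ∃ u, IsGenericOn shiForm i u ∧ shiChamber m u = shiChamber m v := by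
  have hspan : 0 ≤ shiForm i v →
      ((affineSpan ℝ (closure (shiChamber m v) ∩
          hyperplane (root (n + 1) (i.1.1.1 + 1) i.1.1.2) i.2) : Set (V (n + 1))) =
        hyperplane (root (n + 1) (i.1.1.1 + 1) i.1.1.2) i.2 ↔
      ∃ u, IsGenericOn shiForm i u ∧ shiChamber m u = shiChamber m v) := fun hv => by
    rw [← facet_shiForm hv, ← coe_zeroLocus_shiForm, SetLike.coe_set_eq,
      affineSpan_facet_orient_eq_iff (exists_shiForm_pos i) hgen hv]
  rw [IsSepWall, IsWall, separates_shiChamber_iff hne hk, ← shiForm_nonneg_iff]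
  constructor
  · rintro ⟨⟨-, -, h⟩, hv⟩
    exact (hspan hv).1 h
  · rintro ⟨u, hu, huv⟩
    have hne' : (shiChamber m u).Nonempty := huv ▸ hne
    have hv : 0 ≤ shiForm i v := (nonneg_iff_of_chamber_eq hne' huv i).1 hu.1.ge
    refine ⟨⟨mem_arrangement_iff.2 ⟨i, rfl⟩, Or.inl ?_, (hspan hv).2 ⟨u, hu, huv⟩⟩, hv⟩
    have hsep := (separates_shiChamber_iff hne hk).2 (shiForm_nonneg_iff.1 hv)
    intro w hw
    rw [halfGE, mem_ofPred_eq, inner_root]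
    exact (separates_fundAlcove_iff hk).1 hsep w hw

lemma mem_sepSet_iff {i : ShiIndex (n + 1) m} (hk : 1 ≤ (i.2 : ℤ))
    (hgen : ∃ u : V (n + 1), IsGenericOn shiForm i u) {R : Set (V (n + 1))} :
    R ∈ sepSet (n + 1) m (root (n + 1) (i.1.1.1 + 1) i.1.1.2) i.2 ↔
      ∃ u ∈ dominantChamber (n + 1), IsGenericOn shiForm i u ∧ R = shiChamber m u := by
  have hm : 1 ≤ m := by exact_mod_cast hk.trans i.2.2.2
  constructor
  · rintro ⟨⟨hreg, hdom⟩, hwall⟩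
    obtain ⟨v, hne, rfl⟩ := isRegion_iff.1 hreg
    obtain ⟨u, hu, huv⟩ := (isSepWall_shiChamber_iff hk hgen hne).1 hwall
    rw [← huv] at hne hdom
    exact ⟨u, (chamber_subset_dominantChamber_iff hm hne).1 hdom, hu, huv.symm⟩
  · rintro ⟨u, hdom, hu, rfl⟩
    have hne := hu.chamber_nonempty (exists_shiForm_pos i)
    exact ⟨⟨isRegion_iff.2 ⟨u, hne, rfl⟩, (chamber_subset_dominantChamber_iff hm hne).2 hdom⟩,
      (isSepWall_shiChamber_iff hk hgen hne).2 ⟨u, hu, rfl⟩⟩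

end ShiArrangement

section FacetPoints

variable {N m : ℕ} {u u' : V (N + 2)}

/-- The index of the hyperplane `H_{θ,m}`. -/
def thetaIndex (N : ℕ) (hm : 1 ≤ m) : ShiIndex (N + 2) m :=
  (⟨(0, Fin.last (N + 1)), Fin.last_pos⟩, ⟨m, by lia, le_rfl⟩)

lemma shiForm_thetaIndex_eq_zero_iff (hm : 1 ≤ m) :
    shiForm (thetaIndex N hm) u = 0 ↔ gap 0 (Fin.last (N + 1)) u = m := by
  rw [shiForm_eq_zero_iff, thetaIndex, Int.cast_natCast]

/-- The dominant points of `H_{θ,m}` at which no other root takes an integer value. -/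
structure IsFacetPoint (m : ℕ) (u : V (N + 2)) : Prop where
  mem_dominantChamber : u ∈ dominantChamber (N + 2)
  gap_zero_last : gap 0 (Fin.last (N + 1)) u = m
  fract_pos : ∀ a b : Fin (N + 2), a < b → (a, b) ≠ (0, Fin.last (N + 1)) →
    0 < Int.fract (gap a b u)

lemma gap_le_gap_zero_last (hu : u ∈ dominantChamber (N + 2)) (a b : Fin (N + 2)) :
    gap a b u ≤ gap 0 (Fin.last (N + 1)) u :=
  gap_le_gap hu (Fin.zero_le a) (Fin.le_last b)

/-- Dominance and `⟨u, θ⟩ = m` confine all gaps to `[0, m]`, so avoiding the hyperplanes of the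
arrangement means avoiding all integer values. -/
lemma isFacetPoint_iff (hm : 1 ≤ m) : IsFacetPoint m u ↔
    u ∈ dominantChamber (N + 2) ∧ IsGenericOn shiForm (thetaIndex N hm) u := by
  constructor
  · rintro ⟨hdom, hlast, hfract⟩
    refine ⟨hdom, (shiForm_thetaIndex_eq_zero_iff hm).2 hlast, ?_⟩
    rintro ⟨⟨⟨a, b⟩, hab⟩, ⟨k, hk⟩⟩ hne hzero
    have hgap : gap a b u = k := shiForm_eq_zero_iff.1 hzero
    have hab' : (a, b) = (0, Fin.last (N + 1)) := by
      by_contra h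
      simpa [hgap] using hfract a b hab h
    obtain ⟨rfl, rfl⟩ := Prod.mk.inj hab'
    obtain rfl : (m : ℤ) = k := by exact_mod_cast hlast.symm.trans hgap
    exact hne rfl
  · rintro ⟨hdom, hzero, hne⟩
    have hlast : gap 0 (Fin.last (N + 1)) u = m := (shiForm_thetaIndex_eq_zero_iff hm).1 hzero
    refine ⟨hdom, hlast, fun a b hab hab' => (Int.fract_nonneg _).lt_of_ne' fun hfract => ?_⟩
    obtain ⟨k, hk⟩ := Int.fract_eq_zero_iff.1 hfract
    have hk0 : 0 ≤ k := by
      exact_mod_cast hk.symm ▸ mem_dominantChamber_iff.1 hdom a b hab.le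
    have hkm : k ≤ m := by
      exact_mod_cast hk.trans_le ((gap_le_gap_zero_last hdom a b).trans_eq hlast)
    let i : ShiIndex (N + 2) m := (⟨(a, b), hab⟩, ⟨k, by lia, hkm⟩)
    have hi : shiForm i u = 0 := shiForm_eq_zero_iff.2 hk.symm
    exact hne i (fun h => hab' (Subtype.mk.inj (Prod.mk.inj h).1)) hi

lemma mem_sepSet_highestRoot_iff (hm : 1 ≤ m) (hex : ∃ u : V (N + 2), IsFacetPoint m u)
    {R : Set (V (N + 2))} : R ∈ sepSet (N + 2) m (highestRoot (N + 2)) m ↔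
      ∃ u, IsFacetPoint m u ∧ R = shiChamber m u := by
  have hgen : ∃ u : V (N + 2), IsGenericOn shiForm (thetaIndex N hm) u :=
    hex.imp fun u hu => ((isFacetPoint_iff hm).1 hu).2
  have hk : (1 : ℤ) ≤ m := by exact_mod_cast hm
  simp only [isFacetPoint_iff hm, and_assoc]
  rw [highestRoot_eq_root]
  exact mem_sepSet_iff (i := thetaIndex N hm) hk hgen

namespace IsFacetPoint

lemma chamber_nonempty (hm : 1 ≤ m) (hu : IsFacetPoint m u) : (shiChamber m u).Nonempty :=
  ((isFacetPoint_iff hm).1 hu).2.chamber_nonempty (exists_shiForm_pos _)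

lemma gap_pos (hu : IsFacetPoint m u) {a b : Fin (N + 2)} (hab : a < b)
    (hne : (a, b) ≠ (0, Fin.last (N + 1))) : 0 < gap a b u :=
  (mem_dominantChamber_iff.1 hu.mem_dominantChamber a b hab.le).lt_of_ne' fun h =>
    (hu.fract_pos a b hab hne).ne' (by rw [h, Int.fract_zero])

lemma floor_gap_mem_Icc (hu : IsFacetPoint m u) {a b : Fin (N + 2)} (hab : a ≤ b) :
    ⌊gap a b u⌋ ∈ Icc 0 (m : ℤ) := by
  refine ⟨Int.floor_nonneg.2 (mem_dominantChamber_iff.1 hu.mem_dominantChamber a b hab), ?_⟩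
  refine Int.floor_le_iff.2 ((gap_le_gap_zero_last hu.mem_dominantChamber a b).trans_lt ?_)
  simp [hu.gap_zero_last]

lemma shiChamber_eq_iff (hm : 1 ≤ m) (hu : IsFacetPoint m u) (hu' : IsFacetPoint m u') :
    shiChamber m u = shiChamber m u' ↔ ∀ a b, a < b → ⌊gap a b u⌋ = ⌊gap a b u'⌋ := by
  have hle_iff : ∀ (i : ShiIndex (N + 2) m) (v : V (N + 2)),
      0 ≤ shiForm i v ↔ (i.2 : ℤ) ≤ ⌊gap i.1.1.1 i.1.1.2 v⌋ := fun i v => by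
    rw [shiForm_nonneg_iff, Int.le_floor]
  constructor
  · intro h a b hab
    have hside : ∀ k ∈ Icc 0 (m : ℤ), (k ≤ ⌊gap a b u⌋ ↔ k ≤ ⌊gap a b u'⌋) := by
      rintro k ⟨hk, hkm⟩
      simpa only [hle_iff] using nonneg_iff_of_chamber_eq (hu.chamber_nonempty hm) h
        (⟨(a, b), hab⟩, ⟨k, by lia, hkm⟩)
    exact le_antisymm ((hside _ (hu.floor_gap_mem_Icc hab.le)).1 le_rfl)
      ((hside _ (hu'.floor_gap_mem_Icc hab.le)).2 le_rfl)
  · exact fun h => chamber_congr fun i => by rw [hle_iff, hle_iff, h _ _ i.1.2]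

end IsFacetPoint

end FacetPoints

section Statistics

variable {N m : ℕ} {u : V (N + 2)}

lemma ncard_pairs_eq_sum {P : ℕ → ℕ → Prop} (g : Fin N → ℕ) (hg : ∀ i, g i ≤ m)
    (hP : ∀ (i : Fin N) (k : ℕ), 1 ≤ k → k ≤ m → (P (i + 1) k ↔ k ≤ g i)) :
    Set.ncard {x : ℕ × ℕ | (1 ≤ x.1 ∧ x.1 ≤ N) ∧ (1 ≤ x.2 ∧ x.2 ≤ m) ∧ P x.1 x.2} = ∑ i, g i := by
  set F : (Σ _ : Fin N, ℕ) → ℕ × ℕ := fun x => (x.1 + 1, x.2) with hF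
  have hinj : Function.Injective F := by
    rintro ⟨i, k⟩ ⟨j, l⟩ h
    simp only [hF, Prod.mk.injEq, add_left_inj, Fin.val_inj] at h
    obtain ⟨rfl, rfl⟩ := h
    rfl
  have himage : {x : ℕ × ℕ | (1 ≤ x.1 ∧ x.1 ≤ N) ∧ (1 ≤ x.2 ∧ x.2 ≤ m) ∧ P x.1 x.2} =
      F '' (Finset.univ.sigma fun i => Finset.Icc 1 (g i) : Finset (Σ _ : Fin N, ℕ)) := by
    ext ⟨i, k⟩
    simp only [mem_ofPred_eq, mem_image, SetLike.mem_coe, Finset.mem_sigma, Finset.mem_univ,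
      true_and, Finset.mem_Icc, Sigma.exists, hF, Prod.mk.injEq]
    constructor
    · rintro ⟨⟨hi, hi'⟩, ⟨hk, hk'⟩, h⟩
      obtain ⟨i, rfl⟩ := Nat.exists_eq_add_of_le' hi
      exact ⟨⟨i, by lia⟩, k, ⟨hk, (hP ⟨i, by lia⟩ k hk hk').1 h⟩, rfl, rfl⟩
    · rintro ⟨j, l, ⟨hl, hl'⟩, rfl, rfl⟩
      have hlm : l ≤ m := hl'.trans (hg j)
      exact ⟨by lia, ⟨hl, hlm⟩, (hP j l hl hlm).2 hl'⟩
  rw [himage, ncard_image_of_injective _ hinj, ncard_coe_finset, Finset.card_sigma]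
  simp

lemma IsFacetPoint.separates_iff (hu : IsFacetPoint m u) {a b : Fin (N + 2)} (hab : a < b) {k : ℕ}
    (hk : 1 ≤ k) (hkm : k ≤ m) :
    Separates (root (N + 2) (a + 1) b) k (shiChamber m u) (fundAlcove (N + 2)) ↔
      k ≤ ⌊gap a b u⌋.toNat := by
  have hk' : (1 : ℤ) ≤ k := by exact_mod_cast hk
  have hsep := separates_shiChamber_iff (hu.chamber_nonempty (hk.trans hkm))
    (i := (⟨(a, b), hab⟩, ⟨k, by lia, by lia⟩)) hk'
  rw [← Int.le_floor] at hsep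
  exact hsep.trans (Int.le_toNat (hu.floor_gap_mem_Icc hab.le).1).symm

lemma IsFacetPoint.rStat_shiChamber (hu : IsFacetPoint m u) :
    rStat (N + 2) m (shiChamber m u) = ∑ j : Fin (N + 1), ⌊gap 0 j.succ u⌋.toNat := by
  refine ncard_pairs_eq_sum
    (P := fun j k => Separates (root (N + 2) 1 j) k (shiChamber m u) (fundAlcove (N + 2)))
    (fun j : Fin (N + 1) => ⌊gap 0 j.succ u⌋.toNat)
    (fun j => Int.toNat_le.2 (hu.floor_gap_mem_Icc (Fin.zero_le _)).2) fun j k hk hkm => ?_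
  simpa using hu.separates_iff (Fin.succ_pos j) hk hkm

lemma IsFacetPoint.cStat_shiChamber (hu : IsFacetPoint m u) :
    cStat (N + 2) m (shiChamber m u) =
      ∑ i : Fin (N + 1), ⌊gap i.castSucc (Fin.last (N + 1)) u⌋.toNat := by
  refine ncard_pairs_eq_sum
    (P := fun i k => Separates (root (N + 2) i (N + 1)) k (shiChamber m u) (fundAlcove (N + 2)))
    (fun i : Fin (N + 1) => ⌊gap i.castSucc (Fin.last (N + 1)) u⌋.toNat)
    (fun i => Int.toNat_le.2 (hu.floor_gap_mem_Icc (Fin.le_last _)).2) fun i k hk hkm => ?_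
  simpa using hu.separates_iff (Fin.castSucc_lt_last i) hk hkm

end Statistics

section Words

variable {N m : ℕ}

/-- The indices of `Fin (N + 2)` other than the first and the last one. -/
def mid (t : Fin N) : Fin (N + 2) := t.castSucc.succ

lemma mid_lt_mid {s t : Fin N} : mid s < mid t ↔ s < t := by simp [mid]

lemma forall_lt_of_mid {P : Fin (N + 2) → Fin (N + 2) → Prop} (h_zero_last : P 0 (Fin.last (N + 1)))
    (h_zero_mid : ∀ t, P 0 (mid t)) (h_mid_last : ∀ t, P (mid t) (Fin.last (N + 1)))
    (h_mid_mid : ∀ s t, s < t → P (mid s) (mid t)) (a b : Fin (N + 2)) (hab : a < b) : P a b := by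
  induction a using Fin.cases with
  | zero =>
    obtain ⟨b, rfl⟩ := Fin.exists_succ_eq.2 hab.ne'
    induction b using Fin.lastCases with
    | last => exact h_zero_last
    | cast t => exact h_zero_mid t
  | succ a =>
    obtain ⟨b, rfl⟩ := Fin.exists_succ_eq.2 ((Fin.zero_le _).trans_lt hab).ne'
    induction a using Fin.lastCases with
    | last => exact absurd hab (Fin.le_last _).not_gt
    | cast s =>
      induction b using Fin.lastCases with
      | last => exact h_mid_last s
      | cast t => exact h_mid_mid s t (mid_lt_mid.1 hab)

/-- The point `u` of `H_{θ,m}` is coded by the word `w`: the `s`-th letter of `w` is the integer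
part of that number among the `⟨u, α_{1,t}⟩`, `1 ≤ t ≤ N`, which has the `s`-th smallest fractional
part. When `u` is dominant these numbers increase with `t`, so that `Tuple.sort w`, which sorts the
positions by their letters and equal letters from left to right, takes `t` to the rank of the
fractional part of `⟨u, α_{1,t}⟩`. -/
structure IsCodedBy (u : V (N + 2)) (w : Fin N → Fin m) : Prop where
  gap_zero_last : gap 0 (Fin.last (N + 1)) u = m
  floor_gap_zero_mid : ∀ t, ⌊gap 0 (mid t) u⌋ = w (Tuple.sort w t)
  fract_pos : ∀ t, 0 < Int.fract (gap 0 (mid t) u)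
  fract_lt_fract_iff : ∀ s t, Int.fract (gap 0 (mid s) u) < Int.fract (gap 0 (mid t) u) ↔
    Tuple.sort w s < Tuple.sort w t

namespace IsCodedBy

variable {u u' : V (N + 2)} {w w' : Fin N → Fin m}

lemma floor_gap_mid_last (h : IsCodedBy u w) (t : Fin N) :
    ⌊gap (mid t) (Fin.last (N + 1)) u⌋ = m - 1 - w (Tuple.sort w t) := by
  rw [← gap_sub_gap_left 0 (mid t), floor_sub_eq, h.gap_zero_last,
    Int.floor_natCast, Int.fract_natCast, if_pos (h.fract_pos t), h.floor_gap_zero_mid]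
  ring

lemma floor_gap_mid_mid (h : IsCodedBy u w) (s t : Fin N) :
    ⌊gap (mid s) (mid t) u⌋ = w (Tuple.sort w t) - w (Tuple.sort w s) -
      if Tuple.sort w t < Tuple.sort w s then 1 else 0 := by
  simp only [← gap_sub_gap_left 0 (mid s) (mid t), floor_sub_eq,
    h.floor_gap_zero_mid, h.fract_lt_fract_iff]

lemma isFacetPoint (h : IsCodedBy u w) : IsFacetPoint m u := by
  have hnonneg : ∀ a b : Fin (N + 2), a < b → 0 ≤ ⌊gap a b u⌋ := by
    refine forall_lt_of_mid ?_ (fun t => ?_) (fun t => ?_) fun s t hst => ?_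
    · simp [h.gap_zero_last]
    · simp [h.floor_gap_zero_mid]
    · rw [h.floor_gap_mid_last]
      have hlt := (w (Tuple.sort w t)).2
      lia
    · obtain ⟨hmono, hlt⟩ := Tuple.eq_sort_iff.1 (rfl : Tuple.sort w = Tuple.sort w)
      have hle : (w (Tuple.sort w s) : ℕ) ≤ w (Tuple.sort w t) := hmono hst.le
      rw [h.floor_gap_mid_mid]
      split_ifs with hts
      · have hne : (w (Tuple.sort w s) : ℕ) ≠ w (Tuple.sort w t) := fun he =>
          (hlt s t hst (Fin.ext he)).not_gt hts
        lia
      · lia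
  refine ⟨mem_dominantChamber_iff.2 fun a b hab => ?_, h.gap_zero_last, ?_⟩
  · rcases hab.eq_or_lt with rfl | hab
    · simp
    · exact Int.floor_nonneg.1 (hnonneg a b hab)
  · refine forall_lt_of_mid (fun hne => absurd rfl hne) (fun t _ => h.fract_pos t) (fun t _ => ?_)
      fun s t hst _ => ?_
    · rw [← gap_sub_gap_left 0 (mid t), fract_sub_pos_iff, h.gap_zero_last,
        Int.fract_natCast]
      exact (h.fract_pos t).ne
    · rw [← gap_sub_gap_left 0 (mid s) (mid t), fract_sub_pos_iff]
      intro heq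
      have hst' := h.fract_lt_fract_iff s t
      have hts' := h.fract_lt_fract_iff t s
      simp only [heq, lt_irrefl, false_iff, not_lt] at hst' hts'
      exact hst.ne ((Tuple.sort w).injective (hts'.antisymm hst'))

lemma shiChamber_eq_iff (hm : 1 ≤ m) (h : IsCodedBy u w) (h' : IsCodedBy u' w') :
    shiChamber m u = shiChamber m u' ↔ w = w' := by
  rw [h.isFacetPoint.shiChamber_eq_iff hm h'.isFacetPoint]
  constructor
  · intro hfloor
    have hletter : ∀ t, w (Tuple.sort w t) = w' (Tuple.sort w' t) := fun t => by
      have ht := hfloor 0 (mid t) (Fin.succ_pos _)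
      rw [h.floor_gap_zero_mid, h'.floor_gap_zero_mid] at ht
      exact Fin.ext (by exact_mod_cast ht)
    have hsort : Tuple.sort w = Tuple.sort w' := equiv_eq_of_inversions_iff fun s t hst => by
      have h_st := hfloor (mid s) (mid t) (mid_lt_mid.2 hst)
      rw [h.floor_gap_mid_mid, h'.floor_gap_mid_mid, hletter, hletter, sub_right_inj] at h_st
      by_cases hw : Tuple.sort w t < Tuple.sort w s <;>
        by_cases hw' : Tuple.sort w' t < Tuple.sort w' s <;>
        simp only [hw, hw', if_true, if_false, one_ne_zero, zero_ne_one] at h_st ⊢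
    ext t
    simpa [← hsort] using congrArg Fin.val (hletter ((Tuple.sort w).symm t))
  · rintro rfl
    refine forall_lt_of_mid ?_ (fun t => ?_) (fun t => ?_) fun s t _ => ?_
    · rw [h.gap_zero_last, h'.gap_zero_last]
    · rw [h.floor_gap_zero_mid, h'.floor_gap_zero_mid]
    · rw [h.floor_gap_mid_last, h'.floor_gap_mid_last]
    · rw [h.floor_gap_mid_mid, h'.floor_gap_mid_mid]

lemma rStat_shiChamber (h : IsCodedBy u w) :
    rStat (N + 2) m (shiChamber m u) = m + ∑ s, (w s : ℕ) := by
  have hmid : ∀ t : Fin N, ⌊gap 0 t.castSucc.succ u⌋ = w (Tuple.sort w t) := h.floor_gap_zero_mid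
  rw [h.isFacetPoint.rStat_shiChamber, Fin.sum_univ_castSucc, add_comm, Fin.succ_last,
    h.gap_zero_last, ← Equiv.sum_comp (Tuple.sort w) fun s => (w s : ℕ)]
  simp [hmid]

lemma cStat_shiChamber (h : IsCodedBy u w) :
    cStat (N + 2) m (shiChamber m u) = m + ∑ s, (m - 1 - w s : ℕ) := by
  have hmid : ∀ t : Fin N, ⌊gap t.succ.castSucc (Fin.last (N + 1)) u⌋.toNat =
      m - 1 - w (Tuple.sort w t) := fun t => by
    rw [← Fin.succ_castSucc, ← mid, h.floor_gap_mid_last]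
    lia
  rw [h.isFacetPoint.cStat_shiChamber, Fin.sum_univ_succ, Fin.castSucc_zero, h.gap_zero_last,
    ← Equiv.sum_comp (Tuple.sort w) fun s => (m - 1 - w s : ℕ)]
  simp only [hmid, Int.floor_natCast, Int.toNat_natCast]

end IsCodedBy

/-- A point coded by `w`. The fractional parts it realizes are `1 / (N + 1), …, N / (N + 1)`. -/
noncomputable def wordPoint (w : Fin N → Fin m) : V (N + 2) :=
  centre fun a => -(Fin.cons 0 (Fin.snoc (fun t => w (Tuple.sort w t) +
    ((Tuple.sort w t : ℝ) + 1) / (N + 1)) m : Fin (N + 1) → ℝ) : Fin (N + 2) → ℝ) a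

lemma isCodedBy_wordPoint (w : Fin N → Fin m) : IsCodedBy (wordPoint w) w := by
  set r : Fin N → ℝ := fun s => ((s : ℝ) + 1) / (N + 1) with hr
  have hr_pos : ∀ s, 0 < r s := fun s => by positivity
  have hr_lt_one : ∀ s, r s < 1 := fun s => by
    rw [hr, div_lt_one (by positivity)]
    exact_mod_cast Nat.succ_lt_succ s.2
  have hr_lt_iff : ∀ s t, r s < r t ↔ s < t := fun s t => by
    simp [hr, div_lt_div_iff_of_pos_right (show (0 : ℝ) < N + 1 by positivity)]
  have hgap : ∀ t, gap 0 (mid t) (wordPoint w) =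
      ((w (Tuple.sort w t) : ℤ) : ℝ) + r (Tuple.sort w t) := fun t => by
    simp [wordPoint, mid, hr]
  have hfloor : ∀ t, ⌊gap 0 (mid t) (wordPoint w)⌋ = w (Tuple.sort w t) := fun t => by
    rw [hgap, Int.floor_intCast_add, Int.floor_eq_zero_iff.2 ⟨(hr_pos _).le, hr_lt_one _⟩, add_zero]
  have hfract : ∀ t, Int.fract (gap 0 (mid t) (wordPoint w)) = r (Tuple.sort w t) := fun t => by
    rw [hgap, Int.fract_intCast_add, Int.fract_eq_self.2 ⟨(hr_pos _).le, hr_lt_one _⟩]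
  refine ⟨?_, hfloor, fun t => hfract t ▸ hr_pos _, fun s t => ?_⟩
  · simp [wordPoint, ← Fin.succ_last]
  · rw [hfract, hfract, hr_lt_iff]

lemma IsFacetPoint.exists_isCodedBy {u : V (N + 2)} (hu : IsFacetPoint m u) :
    ∃ w : Fin N → Fin m, IsCodedBy u w := by
  set x : Fin N → ℝ := fun t => gap 0 (mid t) u
  have hx_sub : ∀ s t, x t - x s = gap (mid s) (mid t) u := fun s t =>
    gap_sub_gap_left 0 (mid s) (mid t) u
  have hx_mono : StrictMono x := fun s t hst =>
    sub_pos.1 (hx_sub s t ▸ hu.gap_pos (mid_lt_mid.2 hst) (by simp [mid, Fin.succ_ne_zero]))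
  have hfract_inj : Function.Injective (Int.fract ∘ x) := .of_lt_imp_ne fun s t hst heq =>
    fract_sub_pos_iff.1 (hx_sub s t ▸ hu.fract_pos _ _ (mid_lt_mid.2 hst)
      (by simp [mid, Fin.succ_ne_zero])) heq.symm
  have hfloor_lt : ∀ t, ⌊x t⌋ < m := fun t => by
    have hpos := hu.gap_pos (a := mid t) (b := Fin.last (N + 1)) (by simp [mid, ← Fin.succ_last])
      (by simp [mid, Fin.succ_ne_zero])
    rw [← gap_sub_gap_left 0 (mid t), hu.gap_zero_last, sub_pos] at hpos
    exact Int.floor_lt.2 (by exact_mod_cast hpos)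
  have hfloor_nonneg : ∀ t, 0 ≤ ⌊x t⌋ := fun t => (hu.floor_gap_mem_Icc (Fin.zero_le _)).1
  set τ := Tuple.sort (Int.fract ∘ x)
  obtain ⟨w, hw⟩ : ∃ w : Fin N → Fin m, ∀ t, ⌊x t⌋ = w (τ.symm t) :=
    ⟨fun s => ⟨⌊x (τ s)⌋.toNat, (Int.toNat_lt (hfloor_nonneg _)).2 (hfloor_lt _)⟩, fun t => by
      simp [hfloor_nonneg]⟩
  have hfract_lt_iff : ∀ s t, Int.fract (x s) < Int.fract (x t) ↔ τ.symm s < τ.symm t :=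
    fun s t => (sort_symm_lt_sort_symm_iff hfract_inj).symm
  have hsort : τ.symm = Tuple.sort w := by
    refine Tuple.eq_sort_iff.2 ⟨fun s t hst => ?_, fun s t hst heq => (hfract_lt_iff s t).1 ?_⟩
    · have hle := Int.floor_mono (hx_mono.monotone hst)
      rw [hw, hw] at hle
      exact_mod_cast hle
    · rw [Int.fract, Int.fract, hw, hw, heq]
      exact sub_lt_sub_right (hx_mono hst) _
  rw [hsort] at hw hfract_lt_iff
  refine ⟨w, hu.gap_zero_last, hw, fun t => ?_, hfract_lt_iff⟩
  exact hu.fract_pos _ _ (Fin.succ_pos _) (by simp [mid, ← Fin.succ_last])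

lemma sepSet_highestRoot_eq_range (hm : 1 ≤ m) :
    sepSet (N + 2) m (highestRoot (N + 2)) m =
      range fun w : Fin N → Fin m => shiChamber m (wordPoint w) := by
  ext R
  rw [mem_sepSet_highestRoot_iff hm
    ⟨_, (isCodedBy_wordPoint fun _ : Fin N => (⟨0, hm⟩ : Fin m)).isFacetPoint⟩]
  constructor
  · rintro ⟨u, hu, rfl⟩
    obtain ⟨w, hw⟩ := hu.exists_isCodedBy
    exact ⟨w, ((isCodedBy_wordPoint w).shiChamber_eq_iff hm hw).2 rfl⟩
  · rintro ⟨w, rfl⟩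
    exact ⟨wordPoint w, (isCodedBy_wordPoint w).isFacetPoint, rfl⟩

lemma shiChamber_wordPoint_injective (hm : 1 ≤ m) :
    Function.Injective fun w : Fin N → Fin m => shiChamber m (wordPoint w) := fun w w' =>
  ((isCodedBy_wordPoint w).shiChamber_eq_iff hm (isCodedBy_wordPoint w')).1

lemma pqInt_eq_sum_fin {A : Type*} [CommSemiring A] (m : ℕ) (p q : A) :
    pqInt m p q = ∑ j : Fin m, p ^ (m - 1 - j : ℕ) * q ^ (j : ℕ) := by
  rw [pqInt, ← Finset.sum_range_reflect, Finset.sum_range]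
  refine Finset.sum_congr rfl fun j _ => ?_
  rw [Nat.sub_sub_self (Nat.le_sub_one_of_lt j.2)]

end Words

end Shi

theorem mainTheorem1 {A : Type*} [CommSemiring A] (n m : ℕ) (hn : 2 ≤ n) (hm : 1 ≤ m) (p q : A) :
    (Shi.sepSet n m (Shi.highestRoot n) (m : ℤ)).Finite ∧
    Shi.genFun n m (Shi.highestRoot n) p q =
      p ^ m * q ^ m * Shi.pqInt m p q ^ (n - 2) := by
  obtain ⟨N, rfl⟩ := Nat.exists_eq_add_of_le' hn
  rw [Shi.genFun, Shi.sepSet_highestRoot_eq_range hm]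
  refine ⟨Set.finite_range _, ?_⟩
  rw [finsum_mem_range (Shi.shiChamber_wordPoint_injective hm), finsum_eq_sum_of_fintype,
    Nat.add_sub_cancel, Shi.pqInt_eq_sum_fin, Fintype.sum_pow, Finset.mul_sum]
  refine Finset.sum_congr rfl fun w _ => ?_
  have hw := Shi.isCodedBy_wordPoint w
  rw [hw.cStat_shiChamber, hw.rStat_shiChamber, pow_add, pow_add, mul_mul_mul_comm,
    Finset.prod_mul_distrib, Finset.prod_pow_eq_pow_sum, Finset.prod_pow_eq_pow_sum]
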